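/- Let $R>0$, $\alpha>0$, $M>0$, $\varphi_1\in\mathbb R$, and let $f:[\varphi_1,\infty)\to(0,\infty)$ be a twice differentiable function with $f(\varphi)\to 0$ as $\varphi\to\infty$. Let $\Gamma_1$ be the spiral of focus type given in polar coordinates of the plane by $r=f(\varphi)$, $\varphi\ge\varphi_1$. For functions $u,v$ write $u(\varphi)\simeq v(\varphi)$ as $\varphi\to\infty$ if there are constants $c_1,c_2>0$ with $c_1v(\varphi)\le u(\varphi)\le c_2v(\varphi)$ for all sufficiently large $\varphi$. Assume that, as $\varphi\to\infty$, $$f(\varphi)\simeq\varphi^{-\alpha},\qquad |f'(\varphi)|\simeq\varphi^{-\alpha-1},$$ and that $|f''(\varphi)|\le M\varphi^{-\alpha}$ for all sufficiently large $\varphi$. Let $\Gamma_2\subset\mathbb R^3$ be the image of $\Gamma_1$ under the geometric inversion $x\mapsto x/|x|^2$ of $\mathbb R^2\setminus\{0\}$, followed by the projection onto the Poincaré sphere $\{X^2+Y^2+Z^2=R^2\}$: the plane is placed tangentially to the sphere at the north pole $(0,0,R)$ and projected from the centre of the sphere to the open upper hemisphere, that is, $(x,y)\mapsto \frac{R}{\sqrt{x^2+y^2+R^2}}\,(x,y,R)$.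 For a nonempty bounded set $A\subset\mathbb R^n$ let $|A_\varepsilon|$ be the Lebesgue measure of its open $\varepsilon$-neighbourhood. The upper box dimension of $A$ is $$\overline{\dim}_BA=\inf\Big\{s>0:\limsup_{\varepsilon\to0^+}\frac{|A_\varepsilon|}{\varepsilon^{n-s}}=0\Big\},$$ and the lower box dimension is defined in the same way with $\liminf$ in place of $\limsup$; if they are equal, the common value is the box dimension $\dim_BA$. Then $\Gamma_2$ is nonempty and bounded, its box dimension exists, and $$\dim_B\Gamma_2=\frac{2+\alpha}{1+\alpha}.$$ -/

import Mathlib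

open Filter Topology MeasureTheory Set

noncomputable section

/-- The quotient `|A_ε| / ε ^ (n - s)`, where `A_ε` is the open `ε`-neighbourhood of `A ⊆ ℝⁿ` in the
Euclidean metric and `|·|` is `n`-dimensional Lebesgue measure. -/
def minkowskiQuotient {n : ℕ} (A : Set (EuclideanSpace ℝ (Fin n))) (s ε : ℝ) : ENNReal :=
  volume (Metric.thickening ε A) / ENNReal.ofReal (ε ^ ((n : ℝ) - s))

/-- Upper `s`-dimensional Minkowski content. -/
def upperMinkowskiContent {n : ℕ} (s : ℝ) (A : Set (EuclideanSpace ℝ (Fin n))) : ENNReal :=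
  limsup (minkowskiQuotient A s) (𝓝[>] (0 : ℝ))

/-- Lower `s`-dimensional Minkowski content. -/
def lowerMinkowskiContent {n : ℕ} (s : ℝ) (A : Set (EuclideanSpace ℝ (Fin n))) : ENNReal :=
  liminf (minkowskiQuotient A s) (𝓝[>] (0 : ℝ))

/-- Upper box dimension (meaningful for nonempty bounded sets). -/
def upperBoxDim {n : ℕ} (A : Set (EuclideanSpace ℝ (Fin n))) : ℝ :=
  sInf {s : ℝ | 0 < s ∧ upperMinkowskiContent s A = 0}

/-- Lower box dimension (meaningful for nonempty bounded sets). -/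
def lowerBoxDim {n : ℕ} (A : Set (EuclideanSpace ℝ (Fin n))) : ℝ :=
  sInf {s : ℝ | 0 < s ∧ lowerMinkowskiContent s A = 0}

/-- The nonempty bounded set `A ⊆ ℝⁿ` has a box dimension, and it is equal to `d`: the lower and the
upper box dimension both equal `d`. -/
def HasBoxDim {n : ℕ} (A : Set (EuclideanSpace ℝ (Fin n))) (d : ℝ) : Prop :=
  A.Nonempty ∧ Bornology.IsBounded A ∧ lowerBoxDim A = d ∧ upperBoxDim A = d

/-- `u ≃ v` as `t → ∞`: there are positive constants `c₁, c₂` with `c₁ v(t) ≤ u(t) ≤ c₂ v(t)` for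
all sufficiently large `t`. -/
def ComparableAtTop (u v : ℝ → ℝ) : Prop :=
  ∃ c₁ c₂ : ℝ, 0 < c₁ ∧ 0 < c₂ ∧ ∀ᶠ t in atTop, c₁ * v t ≤ u t ∧ u t ≤ c₂ * v t

/-- The function `f : [φ₁, ∞) → (0, ∞)` (only the values on `[φ₁, ∞)` matter) is the radius function
of a twice differentiable spiral of focus type: `f(φ) → 0` as `φ → ∞`. -/
structure IsFocusSpiral (φ₁ : ℝ) (f : ℝ → ℝ) : Prop where
  pos : ∀ φ ∈ Ici φ₁, 0 < f φ
  tendsto_zero : Tendsto f atTop (𝓝 0)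
  differentiable : DifferentiableOn ℝ f (Ici φ₁)
  differentiable_deriv : DifferentiableOn ℝ (derivWithin f (Ici φ₁)) (Ici φ₁)

/-- The planar curve `r = f(φ)`, `φ ≥ φ₁`, in polar coordinates `(r, φ)`. -/
def polarSpiral (φ₁ : ℝ) (f : ℝ → ℝ) : Set (EuclideanSpace ℝ (Fin 2)) :=
  (fun φ : ℝ => !₂[f φ * Real.cos φ, f φ * Real.sin φ]) '' Ici φ₁

/-- The point of space `(x, y, R)`, obtained from `(x, y)` by placing the plane tangentially at the
north pole `(0, 0, R)` of the sphere `X² + Y² + Z² = R²`. -/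
def tangentPlanePoint (R : ℝ) (p : EuclideanSpace ℝ (Fin 2)) : EuclideanSpace ℝ (Fin 3) :=
  !₂[p 0, p 1, R]

/-- Projection onto the Poincaré sphere `X² + Y² + Z² = R²`: central projection, from the centre of
the sphere, of the plane tangent at the north pole to the open upper hemisphere. -/
def poincareProj (R : ℝ) (p : EuclideanSpace ℝ (Fin 2)) : EuclideanSpace ℝ (Fin 3) :=
  (R / ‖tangentPlanePoint R p‖) • tangentPlanePoint R p

/-- The space curve obtained from a planar set by the geometric inversion `x ↦ x / |x|²` followed by
the projection onto the Poincaré sphere of radius `R`. -/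
def invertedOnPoincareSphere (R : ℝ) (Γ : Set (EuclideanSpace ℝ (Fin 2))) :
    Set (EuclideanSpace ℝ (Fin 3)) :=
  poincareProj R '' (EuclideanGeometry.inversion (0 : EuclideanSpace ℝ (Fin 2)) 1 '' Γ)

end

/-! On the sphere the curve has longitude `φ` and latitude `ψ(φ) = arctan (R f(φ))`, so it winds
onto the equator. Successive turns at angle `φ` are about `φ^(-α-1)` apart, which equals `ε` at the
critical angle `q = ε^(-1/(1+α))`. Up to `q` the curve has length of order `q`, hence needs about
`q/ε` balls of radius `ε`; beyond `q` it stays in an equatorial band of width of order `q^(-α) = ε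
q`, which again takes about `q/ε` balls. Conversely, about `q` turns below a multiple of `q` are
separated at scale `ε`, and each carries about `1/ε` separated points. The `ε`-neighbourhood
therefore has volume of order `q ε²`, whose exponent is `3 - (2+α)/(1+α)`. The two halves are
`exists_volume_thickening_le` and `exists_le_volume_thickening`. -/

/-- For `s > d` the quotient tends to `0`; for `s ≤ d` it is at least `c` as soon as `ε < 1`. Both
sets in the definitions are thus `Ioi d`. -/
theorem hasBoxDim_of_volume_bounds {n : ℕ} {A : Set (EuclideanSpace ℝ (Fin n))} {d c C : ℝ}
    (hd : 0 < d) (hne : A.Nonempty) (hb : Bornology.IsBounded A) (hc : 0 < c)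
    (hlow : ∀ᶠ ε in 𝓝[>] (0 : ℝ),
      ENNReal.ofReal (c * ε ^ ((n : ℝ) - d)) ≤ volume (Metric.thickening ε A))
    (hup : ∀ᶠ ε in 𝓝[>] (0 : ℝ),
      volume (Metric.thickening ε A) ≤ ENNReal.ofReal (C * ε ^ ((n : ℝ) - d))) :
    HasBoxDim A d := by
  have hpos : ∀ᶠ ε in 𝓝[>] (0 : ℝ), 0 < ε := eventually_mem_nhdsWithin
  have hlt1 : ∀ᶠ ε in 𝓝[>] (0 : ℝ), ε < 1 :=
    (eventually_lt_nhds zero_lt_one).filter_mono nhdsWithin_le_nhds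
  have big : ∀ s, d < s → Tendsto (minkowskiQuotient A s) (𝓝[>] (0 : ℝ)) (𝓝 0) := by
    intro s hs
    have h1 : Tendsto (fun ε : ℝ => ENNReal.ofReal (C * ε ^ (s - d))) (𝓝[>] (0 : ℝ)) (𝓝 0) := by
      have h2 : Tendsto (fun ε : ℝ => C * ε ^ (s - d)) (𝓝[>] (0 : ℝ)) (𝓝 (C * 0)) := by
        refine Tendsto.const_mul _ ?_
        have h3 : Tendsto (fun ε : ℝ => ε ^ (s - d)) (𝓝 (0 : ℝ)) (𝓝 (0 ^ (s - d))) :=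
          (Real.continuousAt_rpow_const 0 (s - d) (Or.inr (by linarith))).tendsto
        rw [Real.zero_rpow (by linarith)] at h3
        exact h3.mono_left nhdsWithin_le_nhds
      simpa using ENNReal.tendsto_ofReal h2
    refine tendsto_of_tendsto_of_tendsto_of_le_of_le' tendsto_const_nhds h1
      (Eventually.of_forall fun _ => zero_le) ?_
    filter_upwards [hup, hpos] with ε h hε
    unfold minkowskiQuotient
    have hp : 0 < ε ^ ((n : ℝ) - s) := Real.rpow_pos_of_pos hε _
    calc _ ≤ ENNReal.ofReal (C * ε ^ ((n : ℝ) - d)) / ENNReal.ofReal (ε ^ ((n : ℝ) - s)) := by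
          gcongr
      _ = _ := by
          rw [← ENNReal.ofReal_div_of_pos hp, mul_div_assoc, ← Real.rpow_sub hε]
          congr 3; ring
  have small : ∀ s, s ≤ d → 0 < lowerMinkowskiContent s A := by
    intro s hs
    refine lt_of_lt_of_le (ENNReal.ofReal_pos.2 hc) ?_
    refine le_liminf_of_le (by isBoundedDefault) ?_
    filter_upwards [hlow, hpos, hlt1] with ε h hε hε1
    unfold minkowskiQuotient
    have hp : 0 < ε ^ ((n : ℝ) - s) := Real.rpow_pos_of_pos hε _
    calc ENNReal.ofReal c
        ≤ ENNReal.ofReal (c * ε ^ ((n : ℝ) - d)) / ENNReal.ofReal (ε ^ ((n : ℝ) - s)) := by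
          rw [← ENNReal.ofReal_div_of_pos hp, mul_div_assoc, ← Real.rpow_sub hε]
          apply ENNReal.ofReal_le_ofReal
          have : (1 : ℝ) ≤ ε ^ ((n : ℝ) - d - (n - s)) :=
            Real.one_le_rpow_of_pos_of_le_one_of_nonpos hε hε1.le (by linarith)
          nlinarith
      _ ≤ _ := by gcongr
  have hle : ∀ s, lowerMinkowskiContent s A ≤ upperMinkowskiContent s A := fun s =>
    liminf_le_limsup
  refine ⟨hne, hb, ?_, ?_⟩
  · have : {s : ℝ | 0 < s ∧ lowerMinkowskiContent s A = 0} = Ioi d := by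
      ext s
      constructor
      · rintro ⟨_, h⟩
        by_contra hs
        exact (small s (not_lt.1 hs)).ne' h
      · intro hs
        exact ⟨hd.trans hs, (big s hs).liminf_eq⟩
    rw [lowerBoxDim, this, csInf_Ioi]
  · have : {s : ℝ | 0 < s ∧ upperMinkowskiContent s A = 0} = Ioi d := by
      ext s
      constructor
      · rintro ⟨_, h⟩
        by_contra hs
        exact ((small s (not_lt.1 hs)).trans_le (hle s)).ne' h
      · intro hs
        exact ⟨hd.trans hs, (big s hs).limsup_eq⟩
    rw [upperBoxDim, this, csInf_Ioi]

/-! ### Covering and packing by balls in space -/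

theorem volume_ball_three (p : EuclideanSpace ℝ (Fin 3)) {r : ℝ} (hr : 0 < r) :
    volume (Metric.ball p r)
      = ENNReal.ofReal (r ^ 3) * volume (Metric.ball (0 : EuclideanSpace ℝ (Fin 3)) 1) := by
  rw [Measure.addHaar_ball_of_pos _ _ hr]
  simp

theorem volume_unit_ball_three_pos :
    0 < (volume (Metric.ball (0 : EuclideanSpace ℝ (Fin 3)) 1)).toReal :=
  ENNReal.toReal_pos (Metric.measure_ball_pos _ _ one_pos).ne' measure_ball_lt_top.ne

/-- Covering bound for the volume of a neighbourhood. -/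
theorem volume_thickening_le_of_cover {ι : Type*} (s : Finset ι)
    (p : ι → EuclideanSpace ℝ (Fin 3)) {A : Set (EuclideanSpace ℝ (Fin 3))} {ε : ℝ} (hε : 0 < ε)
    (h : ∀ x ∈ A, ∃ i ∈ s, dist x (p i) ≤ ε) :
    volume (Metric.thickening ε A) ≤ ENNReal.ofReal (s.card * (8 * ε ^ 3 *
      (volume (Metric.ball (0 : EuclideanSpace ℝ (Fin 3)) 1)).toReal)) := by
  have hsub : Metric.thickening ε A ⊆ ⋃ i ∈ s, Metric.ball (p i) (2 * ε) := by
    intro y hy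
    obtain ⟨x, hx, hxy⟩ := Metric.mem_thickening_iff.1 hy
    obtain ⟨i, hi, hxi⟩ := h x hx
    refine mem_iUnion₂.2 ⟨i, hi, ?_⟩
    have := dist_triangle y x (p i)
    rw [Metric.mem_ball]
    linarith
  refine (measure_mono hsub).trans ((measure_biUnion_finset_le _ _).trans (le_of_eq ?_))
  rw [Finset.sum_congr rfl fun i _ => volume_ball_three (p i) (by positivity : 0 < 2 * ε)]
  rw [Finset.sum_const, nsmul_eq_mul, ENNReal.ofReal_mul (by positivity),
    ENNReal.ofReal_mul (by positivity), ENNReal.ofReal_toReal measure_ball_lt_top.ne,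
    ENNReal.ofReal_natCast]
  congr 4
  ring

/-- Packing bound for the volume of a neighbourhood. -/
theorem le_volume_thickening_of_separated {ι : Type*} (s : Finset ι)
    (p : ι → EuclideanSpace ℝ (Fin 3)) {A : Set (EuclideanSpace ℝ (Fin 3))} {ε : ℝ} (hε : 0 < ε)
    (hA : ∀ i ∈ s, p i ∈ A)
    (h : ∀ i ∈ s, ∀ j ∈ s, i ≠ j → 2 * ε ≤ dist (p i) (p j)) :
    ENNReal.ofReal (s.card * (ε ^ 3 *
      (volume (Metric.ball (0 : EuclideanSpace ℝ (Fin 3)) 1)).toReal))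
      ≤ volume (Metric.thickening ε A) := by
  have hsub : ⋃ i ∈ s, Metric.ball (p i) ε ⊆ Metric.thickening ε A := by
    refine iUnion₂_subset fun i hi y hy => ?_
    exact Metric.mem_thickening_iff.2 ⟨p i, hA i hi, hy⟩
  refine le_trans (le_of_eq ?_) (measure_mono hsub)
  rw [measure_biUnion_finset]
  · rw [Finset.sum_congr rfl fun i _ => volume_ball_three (p i) hε]
    rw [Finset.sum_const, nsmul_eq_mul, ENNReal.ofReal_mul (by positivity),
      ENNReal.ofReal_mul (by positivity), ENNReal.ofReal_toReal measure_ball_lt_top.ne,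
      ENNReal.ofReal_natCast]
  · intro i hi j hj hij
    refine Metric.ball_disjoint_ball ?_
    linarith [h i hi j hj hij]
  · exact fun _ _ => measurableSet_ball

/-! ### Longitude and latitude on the sphere -/

/-- The point of the sphere of radius `R` with longitude `θ` and latitude `ψ`. -/
noncomputable def spherePoint (R θ ψ : ℝ) : EuclideanSpace ℝ (Fin 3) :=
  !₂[R * (Real.cos θ * Real.cos ψ), R * (Real.sin θ * Real.cos ψ), R * Real.sin ψ]

theorem dist_spherePoint_sq (R θ θ' ψ ψ' : ℝ) :
    dist (spherePoint R θ ψ) (spherePoint R θ' ψ') ^ 2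
      = R ^ 2 * (2 * (1 - Real.cos (ψ - ψ'))
        + 2 * (Real.cos ψ * Real.cos ψ') * (1 - Real.cos (θ - θ'))) := by
  rw [EuclideanSpace.dist_eq, Real.sq_sqrt (by positivity), Fin.sum_univ_three]
  simp only [spherePoint, Real.dist_eq, sq_abs, Real.cos_sub]
  simp
  linear_combination R ^ 2 * (Real.cos ψ ^ 2 * Real.sin_sq_add_cos_sq θ
    + Real.cos ψ' ^ 2 * Real.sin_sq_add_cos_sq θ' + Real.sin_sq_add_cos_sq ψ
    + Real.sin_sq_add_cos_sq ψ')

theorem spherePoint_add_int_mul_two_pi (R θ ψ : ℝ) (n : ℤ) :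
    spherePoint R (θ + n * (2 * Real.pi)) ψ = spherePoint R θ ψ := by
  simp [spherePoint, Real.cos_add_int_mul_two_pi, Real.sin_add_int_mul_two_pi]

theorem dist_spherePoint_le {R : ℝ} (hR : 0 < R) (θ θ' ψ ψ' : ℝ) :
    dist (spherePoint R θ ψ) (spherePoint R θ' ψ') ≤ R * (|θ - θ'| + |ψ - ψ'|) := by
  refine le_of_sq_le_sq ?_ (by positivity)
  rw [dist_spherePoint_sq, mul_pow]
  refine mul_le_mul_of_nonneg_left ?_ (by positivity)
  have h1 := Real.one_sub_sq_div_two_le_cos (x := θ - θ')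
  have h2 := Real.one_sub_sq_div_two_le_cos (x := ψ - ψ')
  have h3 := Real.cos_le_one (θ - θ')
  have h4 : Real.cos ψ * Real.cos ψ' ≤ 1 := by
    have := Real.abs_cos_le_one ψ
    have := Real.abs_cos_le_one ψ'
    calc _ ≤ |Real.cos ψ * Real.cos ψ'| := le_abs_self _
      _ ≤ 1 := by rw [abs_mul]; exact mul_le_one₀ ‹_› (abs_nonneg _) ‹_›
  nlinarith [sq_abs (θ - θ'), sq_abs (ψ - ψ'), mul_nonneg (abs_nonneg (θ - θ')) (abs_nonneg (ψ - ψ'))]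

theorem le_dist_spherePoint {R : ℝ} (hR : 0 < R) {θ θ' ψ ψ' e : ℝ} (hθ : |θ - θ'| ≤ 1)
    (hψ : ψ ∈ Icc 0 1) (hψ' : ψ' ∈ Icc 0 1) (he : 0 ≤ e)
    (h : e ≤ |θ - θ'| ∨ e ≤ |ψ - ψ'|) :
    R / 4 * e ≤ dist (spherePoint R θ ψ) (spherePoint R θ' ψ') := by
  refine le_of_sq_le_sq ?_ dist_nonneg
  rw [dist_spherePoint_sq, mul_pow, div_pow, div_mul_eq_mul_div, mul_div_assoc]
  refine mul_le_mul_of_nonneg_left ?_ (by positivity)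
  have hpi := Real.pi_gt_three
  have hpi4 := Real.pi_lt_four
  -- With `cos ψ * cos ψ' ≥ 1/4`, the longitude term is at least `2 * (1/4) * (e²/8) = (e/4)²`,
  -- whence the factor `R / 4`.
  have key : ∀ x : ℝ, |x| ≤ 1 → x ^ 2 / 8 ≤ 1 - Real.cos x := by
    intro x hx
    have h1 := Real.cos_le_one_sub_mul_cos_sq (x := x) (by linarith)
    have h2 : 1 / 8 ≤ 2 / Real.pi ^ 2 := by
      rw [div_le_div_iff₀ (by norm_num) (by positivity)]; nlinarith
    nlinarith [sq_nonneg x]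
  have hc : ∀ x ∈ Icc (0 : ℝ) 1, 1 / 2 ≤ Real.cos x := by
    intro x hx
    have := Real.one_sub_sq_div_two_le_cos (x := x)
    nlinarith [hx.1, hx.2]
  have h1 := key _ hθ
  have h2 := key (ψ - ψ') (by rw [abs_le]; constructor <;> linarith [hψ.1, hψ.2, hψ'.1, hψ'.2])
  have h3 : 1 / 4 ≤ Real.cos ψ * Real.cos ψ' := by nlinarith [hc _ hψ, hc _ hψ']
  rcases h with h | h
  · have h4 : e ^ 2 ≤ (θ - θ') ^ 2 := by rw [← sq_abs (θ - θ')]; gcongr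
    nlinarith [Real.cos_le_one (θ - θ'), Real.cos_le_one (ψ - ψ')]
  · have h4 : e ^ 2 ≤ (ψ - ψ') ^ 2 := by rw [← sq_abs (ψ - ψ')]; gcongr
    nlinarith [Real.cos_le_one (θ - θ'), Real.cos_le_one (ψ - ψ')]

/-- Inversion keeps the angle and turns the radius into `1 / f φ`; the ray through height `R` above
that point has slope `R * f φ`. -/
theorem invertedOnPoincareSphere_polarSpiral {R φ₁ : ℝ} {f : ℝ → ℝ} (hR : 0 < R)
    (hf : ∀ φ ∈ Ici φ₁, 0 < f φ) :
    invertedOnPoincareSphere R (polarSpiral φ₁ f)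
      = (fun φ => spherePoint R φ (Real.arctan (R * f φ))) '' Ici φ₁ := by
  rw [invertedOnPoincareSphere, polarSpiral, image_image, image_image]
  refine image_congr fun φ hφ => ?_
  have hp := hf φ hφ
  have hn : ‖(!₂[f φ * Real.cos φ, f φ * Real.sin φ] : EuclideanSpace ℝ (Fin 2))‖ = f φ := by
    rw [EuclideanSpace.norm_eq, Fin.sum_univ_two]
    simp only [Real.norm_eq_abs, sq_abs]
    simp only [Matrix.cons_val_zero, Matrix.cons_val_one]
    rw [show (f φ * Real.cos φ) ^ 2 + (f φ * Real.sin φ) ^ 2 = f φ ^ 2 by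
      linear_combination f φ ^ 2 * Real.sin_sq_add_cos_sq φ, Real.sqrt_sq hp.le]
  have hinv : EuclideanGeometry.inversion (0 : EuclideanSpace ℝ (Fin 2)) 1
      !₂[f φ * Real.cos φ, f φ * Real.sin φ] = !₂[Real.cos φ / f φ, Real.sin φ / f φ] := by
    rw [EuclideanGeometry.inversion, dist_zero_right, hn]
    ext i
    fin_cases i <;> simp <;> field_simp
  have hs : 0 < √(1 + (R * f φ) ^ 2) := by positivity
  have hnorm : ‖tangentPlanePoint R !₂[Real.cos φ / f φ, Real.sin φ / f φ]‖
      = √(1 + (R * f φ) ^ 2) / f φ := by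
    rw [tangentPlanePoint, EuclideanSpace.norm_eq, Fin.sum_univ_three, eq_div_iff hp.ne',
      ← Real.sqrt_sq hp.le, ← Real.sqrt_mul (by positivity)]
    congr 1
    simp only [Real.norm_eq_abs, sq_abs]
    simp only [Matrix.cons_val_zero, Matrix.cons_val_one, Matrix.cons_val]
    rw [Real.sqrt_sq hp.le]
    field_simp
    linear_combination Real.sin_sq_add_cos_sq φ
  rw [hinv, poincareProj, hnorm, tangentPlanePoint, spherePoint, Real.cos_arctan, Real.sin_arctan]
  ext i
  fin_cases i <;> simp <;> field_simp

/-! ### Variation of the latitude along the curve -/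

theorem hasDerivWithinAt_latitude {R φ₁ φ : ℝ} {f : ℝ → ℝ} (hf : IsFocusSpiral φ₁ f)
    (hφ : φ ∈ Ici φ₁) :
    HasDerivWithinAt (fun φ => Real.arctan (R * f φ))
      (1 / (1 + (R * f φ) ^ 2) * (R * derivWithin f (Ici φ₁) φ)) (Ici φ₁) φ :=
  ((hf.differentiable φ hφ).hasDerivWithinAt.const_mul R).arctan

/-- The asymptotic bound controls the tail; on the remaining compact interval the derivative is
continuous, being differentiable. -/
theorem IsFocusSpiral.exists_abs_derivWithin_le {α φ₁ : ℝ} {f : ℝ → ℝ} (hα : 0 < α)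
    (hf : IsFocusSpiral φ₁ f)
    (hf1 : ComparableAtTop (fun φ => |derivWithin f (Ici φ₁) φ|) (fun φ => φ ^ (-α - 1))) :
    ∃ L, 0 < L ∧ ∀ φ ∈ Ici φ₁, |derivWithin f (Ici φ₁) φ| ≤ L := by
  obtain ⟨_, c₂, -, hc₂, h⟩ := hf1
  obtain ⟨T, hT⟩ := eventually_atTop.1 h
  obtain ⟨B, hB⟩ := isCompact_Icc.exists_bound_of_continuousOn
    (hf.differentiable_deriv.continuousOn.mono (Icc_subset_Ici_self : Icc φ₁ (max T 1) ⊆ Ici φ₁))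
  refine ⟨max B c₂, lt_max_of_lt_right hc₂, fun φ hφ => ?_⟩
  rcases le_total φ (max T 1) with h1 | h1
  · exact (hB φ ⟨hφ, h1⟩).trans (le_max_left _ _)
  · have h2 := (hT φ ((le_max_left _ _).trans h1)).2
    have h3 : φ ^ (-α - 1) ≤ 1 :=
      Real.rpow_le_one_of_one_le_of_nonpos ((le_max_right _ _).trans h1) (by linarith)
    exact le_max_of_le_right (h2.trans (by nlinarith))

theorem exists_lipschitz_latitude {R α φ₁ : ℝ} {f : ℝ → ℝ} (hR : 0 < R) (hα : 0 < α)
    (hf : IsFocusSpiral φ₁ f)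
    (hf1 : ComparableAtTop (fun φ => |derivWithin f (Ici φ₁) φ|) (fun φ => φ ^ (-α - 1))) :
    ∃ L, 0 < L ∧ ∀ a ∈ Ici φ₁, ∀ b ∈ Ici φ₁,
      |Real.arctan (R * f a) - Real.arctan (R * f b)| ≤ L * |a - b| := by
  obtain ⟨L, hL, h⟩ := hf.exists_abs_derivWithin_le hα hf1
  refine ⟨R * L, by positivity, fun a ha b hb => ?_⟩
  refine (convex_Ici φ₁).norm_image_sub_le_of_norm_hasDerivWithin_le
    (fun x hx => hasDerivWithinAt_latitude hf hx) (fun x hx => ?_) hb ha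
  rw [Real.norm_eq_abs, abs_mul, abs_mul, abs_of_pos hR, abs_of_pos (by positivity)]
  have h1 : 1 / (1 + (R * f x) ^ 2) ≤ 1 := by
    rw [div_le_one (by positivity)]; nlinarith [sq_nonneg (R * f x)]
  have h2 := mul_le_mul_of_nonneg_left (h x hx) hR.le
  have h3 : 0 ≤ R * |derivWithin f (Ici φ₁) x| := by positivity
  nlinarith

theorem latitude_le {R α φ₁ : ℝ} {f : ℝ → ℝ} (hR : 0 < R) (hf : IsFocusSpiral φ₁ f)
    (hf0 : ComparableAtTop f (fun φ => φ ^ (-α))) :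
    ∃ C, 0 < C ∧ ∀ᶠ φ in atTop, 0 ≤ Real.arctan (R * f φ) ∧
      Real.arctan (R * f φ) ≤ C * φ ^ (-α) := by
  obtain ⟨_, c₂, -, hc₂, h⟩ := hf0
  refine ⟨R * c₂, by positivity, ?_⟩
  filter_upwards [h, eventually_ge_atTop φ₁] with φ h1 h2
  have hp : 0 ≤ Real.arctan (R * f φ) :=
    Real.arctan_nonneg.2 (mul_nonneg hR.le (hf.pos φ h2).le)
  refine ⟨hp, (Real.le_tan hp (Real.arctan_lt_pi_div_two _)).trans ?_⟩
  rw [Real.tan_arctan, mul_assoc]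
  exact mul_le_mul_of_nonneg_left h1.2 hR.le

/-- By the mean value theorem, a lower bound on `|f'|` suffices without any monotonicity of `f`. The
factor `1 / 2` bounds the derivative of `arctan` from below once `R * f ≤ 1`. -/
theorem exists_latitude_gap {R α φ₁ : ℝ} {f : ℝ → ℝ} (hR : 0 < R) (hα : 0 < α)
    (hf : IsFocusSpiral φ₁ f)
    (hf1 : ComparableAtTop (fun φ => |derivWithin f (Ici φ₁) φ|) (fun φ => φ ^ (-α - 1))) :
    ∃ g, 0 < g ∧ ∀ᶠ a in atTop, ∀ b, a < b →
      g * (b - a) * b ^ (-α - 1) ≤ |Real.arctan (R * f a) - Real.arctan (R * f b)| := by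
  obtain ⟨c, _, hc, -, h⟩ := hf1
  have hsmall : ∀ᶠ φ in atTop, f φ < 1 / R := hf.tendsto_zero.eventually_lt_const (by positivity)
  obtain ⟨T, hT⟩ := eventually_atTop.1 (h.and hsmall)
  refine ⟨1 / 2 * (R * c), by positivity, ?_⟩
  filter_upwards [eventually_gt_atTop 0, eventually_gt_atTop φ₁, eventually_ge_atTop T]
    with a ha0 ha1 ha b hab
  have hd : ∀ x ∈ Icc a b, HasDerivWithinAt (fun φ => Real.arctan (R * f φ))
      (1 / (1 + (R * f x) ^ 2) * (R * derivWithin f (Ici φ₁) x)) (Ici φ₁) x :=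
    fun x hx => hasDerivWithinAt_latitude hf (ha1.le.trans hx.1)
  obtain ⟨x, hx, hx'⟩ := exists_hasDerivAt_eq_slope (fun φ => Real.arctan (R * f φ)) _ hab
    (fun x hx => (hd x hx).continuousWithinAt.mono
      (Icc_subset_Ici_self.trans (Ici_subset_Ici.2 ha1.le)))
    (fun x hx => (hd x (Ioo_subset_Icc_self hx)).hasDerivAt (Ici_mem_nhds (ha1.trans hx.1)))
  rw [eq_div_iff (by linarith)] at hx'
  rw [abs_sub_comm, ← hx', abs_mul, abs_mul, abs_mul, abs_of_pos hR,
    abs_of_pos (sub_pos.2 hab), abs_of_pos (by positivity)]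
  obtain ⟨⟨h1, -⟩, h2⟩ := hT x (ha.trans hx.1.le)
  have h3 : 1 / 2 ≤ 1 / (1 + (R * f x) ^ 2) := by
    have h4 : R * f x ≤ 1 := by
      rw [lt_div_iff₀ hR] at h2; linarith
    have h5 : 0 < R * f x := mul_pos hR (hf.pos x (ha1.trans hx.1).le)
    apply one_div_le_one_div_of_le (by positivity)
    nlinarith
  have h6 : b ^ (-α - 1) ≤ x ^ (-α - 1) :=
    Real.rpow_le_rpow_of_nonpos (ha0.trans hx.1) hx.2.le (by linarith)
  have hb : 0 < b - a := sub_pos.2 hab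
  have hb' : 0 < b ^ (-α - 1) := Real.rpow_pos_of_pos (ha0.trans hab) _
  calc 1 / 2 * (R * c) * (b - a) * b ^ (-α - 1)
      = 1 / 2 * (R * (c * b ^ (-α - 1))) * (b - a) := by ring
    _ ≤ 1 / (1 + (R * f x) ^ 2) * (R * |derivWithin f (Ici φ₁) x|) * (b - a) := by
        have : c * b ^ (-α - 1) ≤ |derivWithin f (Ici φ₁) x| :=
          (mul_le_mul_of_nonneg_left h6 hc.le).trans h1
        gcongr

/-! ### The critical angle and the two volume bounds -/

theorem tendsto_rpow_neg_one_div_atTop {α : ℝ} (hα : 0 < α) :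
    Tendsto (fun ε : ℝ => ε ^ (-(1 / (1 + α)))) (𝓝[>] 0) atTop :=
  tendsto_rpow_neg_nhdsGT_zero (neg_neg_of_pos (by positivity))

theorem rpow_cutoff {α ε : ℝ} (hα : 0 < α) (hε : 0 < ε) :
    (ε ^ (-(1 / (1 + α)))) ^ (-α - 1) = ε := by
  rw [← Real.rpow_mul hε.le]
  convert Real.rpow_one ε using 2
  field_simp
  ring

theorem rpow_cutoff' {α ε : ℝ} (hα : 0 < α) (hε : 0 < ε) :
    (ε ^ (-(1 / (1 + α)))) ^ (-α) = ε * ε ^ (-(1 / (1 + α))) := by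
  have hq : 0 < ε ^ (-(1 / (1 + α))) := Real.rpow_pos_of_pos hε _
  nth_rewrite 2 [← rpow_cutoff hα hε]
  rw [← Real.rpow_add_one hq.ne']
  ring_nf

theorem rpow_codim {α ε : ℝ} (hα : 0 < α) (hε : 0 < ε) :
    ε ^ (((3 : ℕ) : ℝ) - (2 + α) / (1 + α)) = ε ^ (-(1 / (1 + α))) * ε ^ 2 := by
  rw [← Real.rpow_natCast ε 2, ← Real.rpow_add hε]
  congr 1
  push_cast
  field_simp
  ring

theorem exists_volume_thickening_le {R α φ₁ L C : ℝ} {ψ : ℝ → ℝ} (hR : 0 < R) (hα : 0 < α)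
    (hL : 0 < L) (hC : 0 < C)
    (hlip : ∀ a ∈ Ici φ₁, ∀ b ∈ Ici φ₁, |ψ a - ψ b| ≤ L * |a - b|)
    (hψ : ∀ᶠ φ in atTop, 0 ≤ ψ φ ∧ ψ φ ≤ C * φ ^ (-α)) :
    ∃ K, ∀ᶠ ε in 𝓝[>] (0 : ℝ),
      volume (Metric.thickening ε ((fun φ => spherePoint R φ (ψ φ)) '' Ici φ₁))
        ≤ ENNReal.ofReal (K * ε ^ (((3 : ℕ) : ℝ) - (2 + α) / (1 + α))) := by
  obtain ⟨T, hT⟩ := eventually_atTop.1 hψ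
  set v := (volume (Metric.ball (0 : EuclideanSpace ℝ (Fin 3)) 1)).toReal with hv
  have hv0 : 0 < v := volume_unit_ball_three_pos
  have hpi := Real.pi_pos
  refine ⟨(2 * (R * (1 + L)) + 1 + (4 * Real.pi * R + 1) * (2 * R * C + 1)) * (8 * v), ?_⟩
  have hq := tendsto_rpow_neg_one_div_atTop hα
  filter_upwards [eventually_mem_nhdsWithin, hq.eventually_ge_atTop 1, hq.eventually_ge_atTop T,
    hq.eventually_ge_atTop (-φ₁),
    (eventually_lt_nhds (zero_lt_one (α := ℝ))).filter_mono nhdsWithin_le_nhds]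
    with ε (hε : 0 < ε) hq1 hqT hqφ hε1
  have hqα := rpow_cutoff' hα hε
  rw [rpow_codim hα hε]
  set q := ε ^ (-(1 / (1 + α))) with hqdef
  have hq0 : 0 < q := by linarith
  -- Mesh sizes for which rounding moves a point by at most `ε`: `δ₁` in the angle along the curve,
  -- `δ₂` in both coordinates of the band.
  set δ₁ := ε / (R * (1 + L)) with hδ₁
  set δ₂ := ε / (2 * R) with hδ₂
  have hδ₁0 : 0 < δ₁ := by positivity
  have hδ₂0 : 0 < δ₂ := by positivity
  have approx : ∀ {x y δ : ℝ}, 0 < δ → 0 ≤ x → x ≤ y →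
      ⌊x / δ⌋₊ ∈ Finset.range (⌊y / δ⌋₊ + 1) ∧ |x - ⌊x / δ⌋₊ * δ| ≤ δ ∧ ⌊x / δ⌋₊ * δ ≤ x := by
    intro x y δ hδ hx hxy
    have h1 : (⌊x / δ⌋₊ : ℝ) * δ ≤ x := by
      rw [← le_div_iff₀ hδ]; exact Nat.floor_le (by positivity)
    have h2 : x < (⌊x / δ⌋₊ + 1 : ℝ) * δ := by
      rw [← div_lt_iff₀ hδ]; exact Nat.lt_floor_add_one _
    refine ⟨Finset.mem_range.2 (Nat.lt_succ_of_le (Nat.floor_le_floor (by gcongr))), ?_, h1⟩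
    rw [abs_of_nonneg (by linarith)]
    linarith
  -- Left summand: centres on the curve for `φ ≤ q`. Right summand: a grid on the band, whose
  -- centres need not lie on the curve.
  let s : Finset (ℕ ⊕ ℕ × ℕ) := (Finset.range (⌊max (q - φ₁) 0 / δ₁⌋₊ + 1)).disjSum
    (Finset.range (⌊2 * Real.pi / δ₂⌋₊ + 1) ×ˢ Finset.range (⌊C * (ε * q) / δ₂⌋₊ + 1))
  let p : ℕ ⊕ ℕ × ℕ → EuclideanSpace ℝ (Fin 3) := Sum.elim
    (fun k => spherePoint R (k * δ₁ + φ₁) (ψ (k * δ₁ + φ₁)))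
    (fun ij => spherePoint R (ij.1 * δ₂) (ij.2 * δ₂))
  refine (volume_thickening_le_of_cover s p hε ?_).trans (ENNReal.ofReal_le_ofReal ?_)
  · rintro _ ⟨φ, hφ, rfl⟩
    have hφ' : φ₁ ≤ φ := hφ
    rcases le_total φ q with h | h
    · obtain ⟨h1, h2, h3⟩ := approx (y := max (q - φ₁) 0) hδ₁0 (sub_nonneg.2 hφ')
        (le_max_of_le_left (by linarith))
      refine ⟨Sum.inl _, Finset.inl_mem_disjSum.2 h1, ?_⟩
      have h4 : |φ - (⌊(φ - φ₁) / δ₁⌋₊ * δ₁ + φ₁)| ≤ δ₁ := by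
        convert h2 using 2; ring
      refine (dist_spherePoint_le hR _ _ _ _).trans ?_
      have h5 := hlip φ hφ (⌊(φ - φ₁) / δ₁⌋₊ * δ₁ + φ₁)
        (by simp only [mem_Ici]; linarith [show 0 ≤ ⌊(φ - φ₁) / δ₁⌋₊ * δ₁ by positivity])
      calc _ ≤ R * (δ₁ + L * δ₁) := by
            gcongr
            exact h5.trans (by gcongr)
        _ = ε := by rw [hδ₁]; field_simp
    · obtain ⟨hψ0, hψ1⟩ := hT φ (hqT.trans h)
      have hψ2 : ψ φ ≤ C * (ε * q) := by
        refine hψ1.trans (mul_le_mul_of_nonneg_left ?_ hC.le)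
        rw [← hqα]
        exact Real.rpow_le_rpow_of_nonpos hq0 h (by linarith)
      set θ := 2 * Real.pi * Int.fract (φ / (2 * Real.pi)) with hθ
      have hθ0 : 0 ≤ θ := by have := Int.fract_nonneg (φ / (2 * Real.pi)); positivity
      have hθ1 : θ ≤ 2 * Real.pi := by
        have := (Int.fract_lt_one (φ / (2 * Real.pi))).le
        nlinarith
      have hφθ : φ = θ + ⌊φ / (2 * Real.pi)⌋ * (2 * Real.pi) := by
        have := Int.floor_add_fract (φ / (2 * Real.pi))
        rw [hθ, mul_comm (2 * Real.pi), ← add_mul, add_comm, this]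
        field_simp
      obtain ⟨h1, h2, -⟩ := approx hδ₂0 hθ0 hθ1
      obtain ⟨h3, h4, -⟩ := approx hδ₂0 hψ0 hψ2
      refine ⟨Sum.inr (_, _), Finset.inr_mem_disjSum.2 (Finset.mk_mem_product h1 h3), ?_⟩
      have h5 : spherePoint R φ (ψ φ) = spherePoint R θ (ψ φ) := by
        nth_rewrite 1 [hφθ]
        exact spherePoint_add_int_mul_two_pi _ _ _ _
      simp only [p, Sum.elim_inr]
      rw [h5]
      refine (dist_spherePoint_le hR _ _ _ _).trans ?_
      calc _ ≤ R * (δ₂ + δ₂) := by gcongr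
        _ = ε := by rw [hδ₂]; field_simp; ring
  · have hcard : (s.card : ℝ) ≤ (2 * (R * (1 + L)) + 1 +
        (4 * Real.pi * R + 1) * (2 * R * C + 1)) * (q / ε) := by
      simp only [s, Finset.card_disjSum, Finset.card_product, Finset.card_range]
      push_cast
      have hqε : q ≤ q / ε := le_div_self hq0.le hε hε1.le
      have hε' : 1 ≤ 1 / ε := by rw [le_div_iff₀ hε]; linarith
      have f1 : (⌊max (q - φ₁) 0 / δ₁⌋₊ : ℝ) ≤ 2 * (R * (1 + L)) * (q / ε) := by
        refine (Nat.floor_le (by positivity)).trans ?_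
        calc max (q - φ₁) 0 / δ₁ ≤ (2 * q) / δ₁ := by
              gcongr; exact max_le (by linarith) (by linarith)
          _ = _ := by rw [hδ₁]; field_simp
      have f2 : (⌊2 * Real.pi / δ₂⌋₊ : ℝ) ≤ 4 * Real.pi * R * (1 / ε) := by
        refine (Nat.floor_le (by positivity)).trans (le_of_eq ?_)
        rw [hδ₂]; field_simp; ring
      have f3 : (⌊C * (ε * q) / δ₂⌋₊ : ℝ) ≤ 2 * R * C * q := by
        refine (Nat.floor_le (by positivity)).trans (le_of_eq ?_)
        rw [hδ₂]; field_simp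
      calc _ ≤ (2 * (R * (1 + L)) * (q / ε) + q / ε) +
            (4 * Real.pi * R * (1 / ε) + 1 / ε) * (2 * R * C * q + q) := by
            gcongr
            linarith
        _ = _ := by ring
    refine (mul_le_mul_of_nonneg_right hcard (by positivity)).trans (le_of_eq ?_)
    rw [← hv]
    field_simp

theorem exists_le_volume_thickening {R α φ₁ g : ℝ} {ψ : ℝ → ℝ} (hR : 0 < R) (hα : 0 < α)
    (hg : 0 < g) (hψ : ∀ᶠ φ in atTop, ψ φ ∈ Icc 0 1)
    (hgap : ∀ᶠ a in atTop, ∀ b, a < b → g * (b - a) * b ^ (-α - 1) ≤ |ψ a - ψ b|) :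
    ∃ c, 0 < c ∧ ∀ᶠ ε in 𝓝[>] (0 : ℝ),
      ENNReal.ofReal (c * ε ^ (((3 : ℕ) : ℝ) - (2 + α) / (1 + α)))
        ≤ volume (Metric.thickening ε ((fun φ => spherePoint R φ (ψ φ)) '' Ici φ₁)) := by
  obtain ⟨T, hT⟩ := eventually_atTop.1 (hψ.and (hgap.and (eventually_ge_atTop φ₁)))
  set v := (volume (Metric.ball (0 : EuclideanSpace ℝ (Fin 3)) 1)).toReal with hv
  have hv0 : 0 < v := volume_unit_ball_three_pos
  have hpi := Real.pi_gt_three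
  have hpi' := Real.pi_lt_d2
  -- Chosen so that `g * 6 * (15 * c₀ * q)^(-α-1) = 8 * ε / R = δ`. Here `6 < 2π` bounds the angle
  -- between turns, and `15 > 4π` bounds all angles used by `15 * c₀ * q`.
  set X := 8 / (6 * g * R) with hX
  have hX0 : 0 < X := by positivity
  set c₀ := X ^ (-(1 / (1 + α))) / 15 with hc₀
  have hc₀0 : 0 < c₀ := by positivity
  have hc₀X : (15 * c₀) ^ (-α - 1) = X := by
    rw [hc₀, mul_div_cancel₀ _ (by norm_num)]
    exact rpow_cutoff hα hX0
  refine ⟨c₀ * R / 32 * v, by positivity, ?_⟩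
  have hq := tendsto_rpow_neg_one_div_atTop hα
  filter_upwards [eventually_mem_nhdsWithin, hq.eventually_ge_atTop (1 / c₀),
    hq.eventually_ge_atTop (2 * T / c₀),
    (eventually_lt_nhds (show 0 < R / 8 by positivity)).filter_mono nhdsWithin_le_nhds]
    with ε (hε : 0 < ε) hq1 hqT hεR
  have hqα := rpow_cutoff hα hε
  rw [rpow_codim hα hε]
  set q := ε ^ (-(1 / (1 + α))) with hqdef
  rw [div_le_iff₀ hc₀0] at hq1 hqT
  have hq0 : 0 < q := Real.rpow_pos_of_pos hε _
  -- Makes `R / 4 * δ = 2 * ε`, the separation needed for disjoint balls.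
  set δ := 8 * ε / R with hδ
  have hδ0 : 0 < δ := by positivity
  have hδ1 : 1 ≤ 1 / δ := by
    rw [le_div_iff₀ hδ0, hδ, one_mul, div_le_iff₀ hR]; linarith
  have floor_half : ∀ x : ℝ, 1 ≤ x → 1 ≤ ⌊x⌋₊ ∧ x / 2 ≤ ⌊x⌋₊ := by
    intro x hx
    have h1 : 1 ≤ ⌊x⌋₊ := Nat.le_floor (by simpa using hx)
    have h2 : (1 : ℝ) ≤ ⌊x⌋₊ := by exact_mod_cast h1
    exact ⟨h1, by linarith [Nat.lt_floor_add_one x]⟩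
  obtain ⟨hn1, hn2⟩ := floor_half (q * c₀) hq1
  obtain ⟨-, hJ⟩ := floor_half (1 / δ) hδ1
  have hn3 : (⌊q * c₀⌋₊ : ℝ) ≤ q * c₀ := Nat.floor_le (by positivity)
  have hJ3 : (⌊1 / δ⌋₊ : ℝ) * δ ≤ 1 := by
    rw [← le_div_iff₀ hδ0]; exact Nat.floor_le (by positivity)
  set n := ⌊q * c₀⌋₊ with hn
  set J := ⌊1 / δ⌋₊ with hJdef
  have hn1' : (1 : ℝ) ≤ n := by exact_mod_cast hn1
  -- Turns `n, …, 2n - 1`, each sampled at longitudes `j * δ` in `[0, 1]`. Distinct `j` are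
  -- separated by longitude; equal `j` on distinct turns by the latitude gap.
  let Φ : ℕ × ℕ → ℝ := fun kj => kj.2 * δ + ((n + kj.1 : ℕ) : ℤ) * (2 * Real.pi)
  have hjδ : ∀ j < J, (j : ℝ) * δ ∈ Icc 0 1 := by
    intro j hj
    refine ⟨by positivity, le_trans ?_ hJ3⟩
    gcongr
  have hΦT : ∀ kj, T ≤ Φ kj := by
    intro kj
    simp only [Φ]
    push_cast
    have h1 : 0 ≤ (kj.2 : ℝ) * δ := by positivity
    have h2 : (0 : ℝ) ≤ kj.1 := by positivity
    nlinarith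
  have hgapΦ : ∀ j < J, ∀ k < n, ∀ k' < n, k < k' → δ ≤ |ψ (Φ (k, j)) - ψ (Φ (k', j))| := by
    intro j hj k hk k' hk' hkk
    have h0 : (k : ℝ) + 1 ≤ k' := by exact_mod_cast hkk
    have h0' : (k' : ℝ) + 1 ≤ n := by exact_mod_cast hk'
    have h1 : 6 ≤ Φ (k', j) - Φ (k, j) := by
      simp only [Φ]; push_cast; nlinarith
    have h2 : Φ (k', j) ≤ 15 * (c₀ * q) := by
      have := (hjδ j hj).2
      simp only [Φ]; push_cast; nlinarith
    have hpos : 0 < Φ (k', j) := by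
      have := (hjδ j hj).1
      simp only [Φ]; push_cast; positivity
    refine le_trans ?_ ((hT _ (hΦT (k, j))).2.1 _ (by linarith))
    calc δ = g * 6 * (15 * (c₀ * q)) ^ (-α - 1) := by
          rw [← mul_assoc, Real.mul_rpow (by positivity) hq0.le, hc₀X, hqα, hX, hδ]
          field_simp
      _ ≤ _ := by
          have := Real.rpow_le_rpow_of_nonpos hpos h2 (z := -α - 1) (by linarith)
          gcongr
  have hsp : ∀ kj, spherePoint R (Φ kj) (ψ (Φ kj)) = spherePoint R (kj.2 * δ) (ψ (Φ kj)) :=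
    fun kj => spherePoint_add_int_mul_two_pi _ _ _ _
  refine le_trans (ENNReal.ofReal_le_ofReal ?_) (le_volume_thickening_of_separated
    (Finset.range n ×ˢ Finset.range J) (fun kj => spherePoint R (Φ kj) (ψ (Φ kj))) hε ?_ ?_)
  · rw [Finset.card_product, Finset.card_range, Finset.card_range]
    push_cast
    calc c₀ * R / 32 * v * (q * ε ^ 2) = (q * c₀ / 2) * (1 / δ / 2) * (ε ^ 3 * v) := by
          rw [hδ]; field_simp; ring
      _ ≤ _ := by gcongr
  · exact fun kj _ => mem_image_of_mem _ (hT _ (hΦT kj)).2.2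
  · rintro ⟨k, j⟩ hkj ⟨k', j'⟩ hkj' hne
    simp only [Finset.mem_product, Finset.mem_range] at hkj hkj'
    have hθ := hjδ j hkj.2
    have hθ' := hjδ j' hkj'.2
    have h2 : 2 * ε = R / 4 * δ := by rw [hδ]; field_simp; ring
    simp only [hsp]
    rw [h2]
    refine le_dist_spherePoint hR (abs_le.2 ⟨by linarith [hθ.1, hθ'.2], by linarith [hθ.2, hθ'.1]⟩)
      (hT _ (hΦT _)).1 (hT _ (hΦT _)).1 hδ0.le ?_
    by_cases hjj : j = j'
    · subst hjj
      right
      have hkk : k ≠ k' := fun h => hne (by rw [h])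
      rcases lt_or_gt_of_ne hkk with h | h
      · exact hgapΦ j hkj.2 k hkj.1 k' hkj'.1 h
      · rw [abs_sub_comm]
        exact hgapΦ j hkj.2 k' hkj'.1 k hkj.1 h
    · left
      rw [← sub_mul, abs_mul, abs_of_pos hδ0]
      have h3 : (1 : ℝ) ≤ |(j : ℝ) - j'| := by
        have : (1 : ℤ) ≤ |(j : ℤ) - j'| := Int.one_le_abs (sub_ne_zero.2 (by exact_mod_cast hjj))
        exact_mod_cast this
      nlinarith

theorem isBounded_image_spherePoint (R : ℝ) (θ ψ : ℝ → ℝ) (s : Set ℝ) :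
    Bornology.IsBounded ((fun t => spherePoint R (θ t) (ψ t)) '' s) := by
  refine (Metric.isBounded_iff_subset_closedBall 0).2 ⟨|R|, ?_⟩
  rintro _ ⟨t, -, rfl⟩
  rw [mem_closedBall_zero_iff, EuclideanSpace.norm_eq, Fin.sum_univ_three, ← Real.sqrt_sq_eq_abs]
  refine le_of_eq (congrArg _ ?_)
  simp only [Real.norm_eq_abs, sq_abs, spherePoint]
  simp
  linear_combination R ^ 2 * (Real.cos (ψ t) ^ 2 * Real.sin_sq_add_cos_sq (θ t)
    + Real.sin_sq_add_cos_sq (ψ t))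

theorem proposition2p30 (R : ℝ) (hR : 0 < R) (α : ℝ) (hα : 0 < α) (M : ℝ) (hM : 0 < M)
    (φ₁ : ℝ) (f : ℝ → ℝ) (hf : IsFocusSpiral φ₁ f)
    (hf0 : ComparableAtTop f (fun φ => φ ^ (-α)))
    (hf1 : ComparableAtTop (fun φ => |derivWithin f (Ici φ₁) φ|) (fun φ => φ ^ (-α - 1)))
    (hf2 : ∀ᶠ φ in atTop,
      |derivWithin (derivWithin f (Ici φ₁)) (Ici φ₁) φ| ≤ M * φ ^ (-α)) :
    HasBoxDim (invertedOnPoincareSphere R (polarSpiral φ₁ f)) ((2 + α) / (1 + α)) := by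
  rw [invertedOnPoincareSphere_polarSpiral hR hf.pos]
  obtain ⟨L, hL, hlip⟩ := exists_lipschitz_latitude hR hα hf hf1
  obtain ⟨C, hC, hle⟩ := latitude_le hR hf hf0
  obtain ⟨g, hg, hgap⟩ := exists_latitude_gap hR hα hf hf1
  have htend : Tendsto (fun φ => Real.arctan (R * f φ)) atTop (𝓝 0) := by
    have h := (Real.continuous_arctan.tendsto (R * 0)).comp (hf.tendsto_zero.const_mul R)
    simpa [Function.comp_def] using h
  have hIcc : ∀ᶠ φ in atTop, Real.arctan (R * f φ) ∈ Icc 0 1 := by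
    filter_upwards [hle, htend.eventually_le_const one_pos] with φ h1 h2 using ⟨h1.1, h2⟩
  obtain ⟨K, hK⟩ := exists_volume_thickening_le hR hα hL hC hlip hle
  obtain ⟨c, hc, hlow⟩ := exists_le_volume_thickening (φ₁ := φ₁) hR hα hg hIcc hgap
  exact hasBoxDim_of_volume_bounds (by positivity) (nonempty_Ici.image _)
    (isBounded_image_spherePoint R _ _ _) hc hlow hK
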